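/- Let $\widehat{\mathrm{G}}_0^1$ be the group, under composition, of formal diffeomorphisms of $(\mathbb{C},0)$, that is, of formal power series $f=\sum_{\ell\geq 1}a_\ell x^\ell$ with $a_\ell\in\mathbb{C}$ and $a_1\neq 0$. For an automorphism $\tau$ of the field $\mathbb{C}$ let $\sigma^\tau$ be the automorphism $\sum_{\ell\ge 1} a_\ell x^\ell\mapsto\sum_{\ell\ge 1}\tau(a_\ell)x^\ell$ of $\widehat{\mathrm{G}}_0^1$. Then $\mathrm{Aut}(\widehat{\mathrm{G}}_0^1)$ is generated by the inner automorphisms and the automorphisms $\sigma^\tau$, $\tau\in\mathrm{Aut}(\mathbb{C},+,\cdot)$; more precisely, every automorphism of $\widehat{\mathrm{G}}_0^1$ is the composition of an inner automorphism $f\mapsto\varphi\circ f\circ\varphi^{-1}$ with some $\sigma^\tau$. Hence $\mathrm{Out}(\widehat{\mathrm{G}}_0^1)\simeq\mathrm{Aut}(\mathbb{C},+,\cdot)$, where $\mathrm{Out}(\widehat{\mathrm{G}}_0^1)$ is the quotient of $\mathrm{Aut}(\widehat{\mathrm{G}}_0^1)$ by the subgroup of inner automorphisms; an isomorphism $\mathrm{Aut}(\mathbb{C},+,\cdot)\to\mathrm{Out}(\widehat{\mathrm{G}}_0^1)$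 is given by sending $\tau$ to the class of $\sigma^\tau$. -/

import Mathlib

/-- A formal diffeomorphism of `(ℂ, 0)`: a formal power series `f` in one variable over `ℂ` with
`f(0) = 0` whose derivative at `0` (the coefficient of degree one) is invertible. -/
@[ext]
structure FormalDiff where
  /-- The underlying formal power series. -/
  toSeries : PowerSeries ℂ
  /-- The series vanishes at the origin. -/
  constantCoeff_eq : PowerSeries.constantCoeff toSeries = 0
  /-- The differential at the origin is invertible. -/
  coeff_one_ne : PowerSeries.coeff 1 toSeries ≠ 0

namespace FormalDiff

theorem hasSubst (f : FormalDiff) : PowerSeries.HasSubst f.toSeries :=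
  PowerSeries.HasSubst.of_constantCoeff_zero' f.constantCoeff_eq

theorem isUnit_coeff_one (f : FormalDiff) : IsUnit (PowerSeries.coeff 1 f.toSeries) :=
  isUnit_iff_ne_zero.mpr f.coeff_one_ne

theorem constantCoeff_subst (f g : FormalDiff) :
    PowerSeries.constantCoeff (f.toSeries.subst g.toSeries) = 0 :=
  PowerSeries.constantCoeff_subst_eq_zero g.constantCoeff_eq f.toSeries f.constantCoeff_eq

theorem coeff_one_subst (f g : FormalDiff) :
    PowerSeries.coeff 1 (f.toSeries.subst g.toSeries) =
      PowerSeries.coeff 1 f.toSeries * PowerSeries.coeff 1 g.toSeries := by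
  rw [PowerSeries.coeff_subst' g.hasSubst, finsum_eq_single _ 1]
  · simp
  · intro n hn
    obtain ⟨h, hh⟩ := PowerSeries.X_dvd_iff.mpr g.constantCoeff_eq
    rcases n with _ | _ | n
    · simp [PowerSeries.coeff_one]
    · exact absurd rfl hn
    · simp [hh, mul_pow, PowerSeries.coeff_X_pow_mul']

/-- The product is the composition: `f * g` is the series `f(g(x))`. -/
noncomputable instance : Mul FormalDiff where
  mul f g :=
    { toSeries := f.toSeries.subst g.toSeries
      constantCoeff_eq := constantCoeff_subst f g
      coeff_one_ne := by
        rw [coeff_one_subst]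
        exact mul_ne_zero f.coeff_one_ne g.coeff_one_ne }

/-- The neutral element is the identity series `x`. -/
noncomputable instance : One FormalDiff where
  one :=
    { toSeries := PowerSeries.X
      constantCoeff_eq := by simp
      coeff_one_ne := by simp }

/-- The inverse is the compositional inverse. -/
noncomputable instance : Inv FormalDiff where
  inv f :=
    { toSeries := f.toSeries.substInvOfIsUnit f.isUnit_coeff_one
      constantCoeff_eq := by simp
      coeff_one_ne := by
        rw [PowerSeries.coeff_one_substInvOfIsUnit]
        exact Units.ne_zero _ }

theorem toSeries_mul (f g : FormalDiff) :
    (f * g).toSeries = f.toSeries.subst g.toSeries := rfl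

theorem toSeries_one : (1 : FormalDiff).toSeries = PowerSeries.X := rfl

theorem toSeries_inv (f : FormalDiff) :
    (f⁻¹).toSeries = f.toSeries.substInvOfIsUnit f.isUnit_coeff_one := rfl

/-- The group of formal diffeomorphisms of `(ℂ, 0)` under composition. -/
noncomputable instance : Group FormalDiff :=
  Group.ofLeftAxioms
    (fun f g h => by
      ext1
      simp only [toSeries_mul]
      exact PowerSeries.subst_comp_subst_apply g.hasSubst h.hasSubst f.toSeries)
    (fun f => by
      ext1
      rw [toSeries_mul, toSeries_one, PowerSeries.subst_X f.hasSubst])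
    (fun f => by
      ext1
      rw [toSeries_mul, toSeries_inv, toSeries_one]
      exact PowerSeries.subst_substInvOfIsUnit_left f.toSeries f.constantCoeff_eq _)

/-- The coefficientwise action of a field automorphism `τ` of `ℂ` on a formal diffeomorphism:
`∑ aₙ xⁿ` is sent to `∑ τ(aₙ) xⁿ`. -/
noncomputable def mapCoeff (τ : RingAut ℂ) (f : FormalDiff) : FormalDiff where
  toSeries := PowerSeries.map (τ : ℂ →+* ℂ) f.toSeries
  constantCoeff_eq := by
    rw [← PowerSeries.coeff_zero_eq_constantCoeff_apply, PowerSeries.coeff_map,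
      PowerSeries.coeff_zero_eq_constantCoeff_apply, f.constantCoeff_eq, map_zero]
  coeff_one_ne := by
    rw [PowerSeries.coeff_map]
    exact (map_ne_zero_iff _ τ.injective).mpr f.coeff_one_ne

theorem coeff_mapCoeff (τ : RingAut ℂ) (f : FormalDiff) (n : ℕ) :
    PowerSeries.coeff n (mapCoeff τ f).toSeries = τ (PowerSeries.coeff n f.toSeries) :=
  PowerSeries.coeff_map _ _ _

theorem mapCoeff_mul (τ : RingAut ℂ) (f g : FormalDiff) :
    mapCoeff τ (f * g) = mapCoeff τ f * mapCoeff τ g := by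
  ext1
  exact PowerSeries.map_subst g.hasSubst f.toSeries

/-- The homomorphism from the group of field automorphisms of `ℂ` to the group of automorphisms of
`FormalDiff`, given by the coefficientwise action. -/
noncomputable def fieldAut : RingAut ℂ →* MulAut FormalDiff where
  toFun τ :=
    { toFun := mapCoeff τ
      invFun := mapCoeff τ⁻¹
      left_inv := fun f => by
        ext n
        rw [coeff_mapCoeff, coeff_mapCoeff]
        exact τ.symm_apply_apply _
      right_inv := fun f => by
        ext n
        rw [coeff_mapCoeff, coeff_mapCoeff]
        exact τ.apply_symm_apply _
      map_mul' := mapCoeff_mul τ }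
  map_one' := by
    ext f n
    exact coeff_mapCoeff 1 f n
  map_mul' τ υ := by
    ext f n
    change PowerSeries.coeff n (mapCoeff (τ * υ) f).toSeries =
      PowerSeries.coeff n (mapCoeff τ (mapCoeff υ f)).toSeries
    rw [coeff_mapCoeff, coeff_mapCoeff, coeff_mapCoeff]
    rfl

end FormalDiff

/-- The subgroup `Inn(G)` of inner automorphisms `x ↦ g x g⁻¹` of `G` in `Aut(G)`. -/
def Inn (G : Type*) [Group G] : Subgroup (MulAut G) :=
  (MulAut.conj : G →* MulAut G).range

instance Inn.normal (G : Type*) [Group G] : (Inn G).Normal where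
  conj_mem := by
    rintro _ ⟨g, rfl⟩ σ
    refine ⟨σ g, ?_⟩
    ext x
    simp [MulAut.conj_apply, MulAut.mul_apply]

/-- The outer automorphism group `Out(G) = Aut(G) / Inn(G)`. -/
abbrev Out (G : Type*) [Group G] : Type _ :=
  MulAut G ⧸ Inn G

/-!
Write `lin a` for the linear map `a x`, `parabolic t` for `x / (1 - t x)`, and `Γ n` for the group of
the series `x + O(x ^ (n + 1))`. An automorphism is first normalized, by an inner automorphism and a
field automorphism, so that it fixes the affine group made of the `lin a` and the `parabolic t`; such
an automorphism is then shown to be trivial.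

Normalization. The group `Γ 1` is the commutator subgroup, since the product of a tangent to
identity `f` with `2 x` is linearizable. Hence the multiplier `μ` of the image of `2 x` is not a
root of unity, and after conjugation `2 x` is sent to `μ x`. Taking centralizers, the automorphism
permutes the linear maps, say `lin a ↦ lin (χ a)`. The image `g` of `parabolic 1` is tangent to the
identity, and satisfies `g ^ 2 = μ⁻¹ g(μ x)`, because `parabolic 1` satisfies this for `μ = 2`. If
`g = x + a x ^ (k + 1) + ⋯` then `μ ^ k = 2`, and `g` is determined by `a` and this equation
(`eq_of_pow_eq_scale`). So `g` commutes with `χ ζ`, where `ζ` is a primitive `k`-th root of unity,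
hence `parabolic 1` commutes with `ζ`: this forces `k = 1`, `μ = 2` and `g = parabolic a`
(`map_parabolic_one`). After a linear conjugation `a = 1`, and then `parabolic t ↦ parabolic (χ t)`,
which shows that `χ` is additive: it is a field automorphism (`exists_conj_map_affine`).

Rigidity. For an automorphism fixing the affine group, solving `f ^ 2 ^ k * h = 2⁻¹ f(2 x)` in `f`
describes `Γ (k + 1)` in terms of `Γ k` and `2 x`, so the filtration is preserved (`map_mem_Γ`). The
automorphism commutes with the linear maps, so it acts on `Γ k / Γ (k + 1) ≃ ℂ` by a scalar `c k`.
The bracket `[x ^ (k + 1) ∂, x ^ (l + 1) ∂] = (l - k) x ^ (k + l + 1) ∂` gives `c (k + l) = c k * c l`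
for `k ≠ l`, and `c 1 = 1`; so `c` is constant from `2` on, and `c 5 = c 2 * c 3` shows that the
constant is `1` (`map_binom_coeff`). Finally the obstruction to the automorphism being trivial to the
next order is an additive function on `Γ 1`, of weight different from those of all the graded pieces
on which it could be nonzero (`map_eq_self_of_mem`).

Injectivity of `Aut(ℂ) → Out` holds because inner automorphisms preserve multipliers.
-/

/-! ### Coefficients, jets and substitution -/

namespace PowerSeries

/-- Substitution is continuous for the `X`-adic topology, in the series substituted. -/
theorem X_pow_dvd_subst_sub_subst {f g : PowerSeries ℂ} (hf : constantCoeff f = 0)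
    (hg : constantCoeff g = 0) {n : ℕ} (h : X ^ n ∣ f - g) (p : PowerSeries ℂ) :
    (X : PowerSeries ℂ) ^ n ∣ p.subst f - p.subst g := by
  rw [X_pow_dvd_iff] at *
  intro i hi
  rw [map_sub, sub_eq_zero, coeff_subst' (HasSubst.of_constantCoeff_zero' hf),
    coeff_subst' (HasSubst.of_constantCoeff_zero' hg)]
  refine finsum_congr fun m => ?_
  have := X_pow_dvd_iff.mp ((X_pow_dvd_iff.mpr h).trans (sub_dvd_pow_sub_pow f g m)) i hi
  rw [map_sub, sub_eq_zero] at this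
  rw [this]

theorem C_subst (a : ℂ) (f : PowerSeries ℂ) : (C a).subst f = C a :=
  subst_C a

theorem exists_eq_C_add_X_mul (f : PowerSeries ℂ) :
    ∃ g : PowerSeries ℂ, f = C (constantCoeff f) + X * g := by
  obtain ⟨g, hg⟩ := X_dvd_iff.mpr (show constantCoeff (f - C (constantCoeff f)) = 0 by simp)
  exact ⟨g, by rw [← hg]; ring⟩

end PowerSeries

namespace FormalDiff

/-- The coefficient of degree `n` of a formal diffeomorphism. -/
noncomputable def coeff (f : FormalDiff) (n : ℕ) : ℂ := PowerSeries.coeff n f.toSeries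

theorem ext_coeff {f g : FormalDiff} (h : ∀ n, f.coeff n = g.coeff n) : f = g := by
  ext n
  exact h n

@[simp] theorem coeff_zero (f : FormalDiff) : f.coeff 0 = 0 := by
  rw [coeff, PowerSeries.coeff_zero_eq_constantCoeff_apply, f.constantCoeff_eq]

theorem coeff_one_ne_zero (f : FormalDiff) : f.coeff 1 ≠ 0 := f.coeff_one_ne

@[simp] theorem one_coeff_one : (1 : FormalDiff).coeff 1 = 1 := by
  simp [coeff, toSeries_one]

theorem one_coeff_of_ne {n : ℕ} (hn : n ≠ 1) : (1 : FormalDiff).coeff n = 0 := by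
  simp [coeff, toSeries_one, PowerSeries.coeff_X, hn]

@[simp] theorem mul_coeff_one (f g : FormalDiff) : (f * g).coeff 1 = f.coeff 1 * g.coeff 1 :=
  coeff_one_subst f g

theorem fieldAut_coeff (τ : RingAut ℂ) (f : FormalDiff) (n : ℕ) :
    (fieldAut τ f).coeff n = τ (f.coeff n) :=
  coeff_mapCoeff τ f n

/-- The multiplier `f ↦ f'(0)`, as a homomorphism. -/
noncomputable def multiplier : FormalDiff →* ℂ where
  toFun f := f.coeff 1
  map_one' := one_coeff_one
  map_mul' := mul_coeff_one

theorem multiplier_apply (f : FormalDiff) : multiplier f = f.coeff 1 := rfl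

/-- The formal diffeomorphism with a given sequence of coefficients. -/
noncomputable def ofCoeff (s : ℕ → ℂ) (h₀ : s 0 = 0) (h₁ : s 1 ≠ 0) : FormalDiff where
  toSeries := PowerSeries.mk s
  constantCoeff_eq := by
    rw [← PowerSeries.coeff_zero_eq_constantCoeff_apply, PowerSeries.coeff_mk, h₀]
  coeff_one_ne := by rwa [PowerSeries.coeff_mk]

@[simp] theorem ofCoeff_coeff (s : ℕ → ℂ) (h₀ : s 0 = 0) (h₁ : s 1 ≠ 0) (n : ℕ) :
    (ofCoeff s h₀ h₁).coeff n = s n :=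
  PowerSeries.coeff_mk _ _

/-- `f` and `g` have the same jet of order `n`. -/
def SameJet (n : ℕ) (f g : FormalDiff) : Prop := ∀ i ≤ n, f.coeff i = g.coeff i

theorem SameJet.refl (n : ℕ) (f : FormalDiff) : SameJet n f f := fun _ _ => rfl

theorem SameJet.symm {n : ℕ} {f g : FormalDiff} (h : SameJet n f g) : SameJet n g f :=
  fun i hi => (h i hi).symm

theorem SameJet.trans {n : ℕ} {f g h : FormalDiff} (h₁ : SameJet n f g) (h₂ : SameJet n g h) :
    SameJet n f h :=
  fun i hi => (h₁ i hi).trans (h₂ i hi)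

theorem SameJet.mono {m n : ℕ} (hmn : m ≤ n) {f g : FormalDiff} (h : SameJet n f g) :
    SameJet m f g :=
  fun i hi => h i (hi.trans hmn)

theorem SameJet.succ {n : ℕ} {f g : FormalDiff} (h : SameJet n f g)
    (h' : f.coeff (n + 1) = g.coeff (n + 1)) : SameJet (n + 1) f g := by
  intro i hi
  rcases Nat.le_succ_iff.mp hi with hi | rfl
  · exact h i hi
  · exact h'

theorem eq_of_forall_sameJet {f g : FormalDiff} (h : ∀ n, 1 ≤ n → SameJet n f g) : f = g :=
  ext_coeff fun n => h (n + 1) (by omega) n (by omega)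

theorem sameJet_iff_dvd {n : ℕ} {f g : FormalDiff} :
    SameJet n f g ↔ (PowerSeries.X : PowerSeries ℂ) ^ (n + 1) ∣ f.toSeries - g.toSeries := by
  rw [PowerSeries.X_pow_dvd_iff]
  simp only [SameJet, map_sub, sub_eq_zero, Nat.lt_succ_iff, coeff]

theorem SameJet.exists_eq {n : ℕ} {f g : FormalDiff} (h : SameJet n f g) :
    ∃ q : PowerSeries ℂ, f.toSeries = g.toSeries + PowerSeries.X ^ (n + 1) * q ∧
      PowerSeries.constantCoeff q = f.coeff (n + 1) - g.coeff (n + 1) := by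
  obtain ⟨q, hq⟩ := sameJet_iff_dvd.mp h
  refine ⟨q, by rw [← hq]; ring, ?_⟩
  have := congrArg (PowerSeries.coeff (n + 1)) hq
  rw [map_sub, PowerSeries.coeff_X_pow_mul', if_pos le_rfl, Nat.sub_self,
    PowerSeries.coeff_zero_eq_constantCoeff_apply] at this
  exact this.symm

/-- Two diffeomorphisms with the same jet of order `n` still have the same jet after composition on
the right, and the difference of their next coefficients is multiplied by a power of the
multiplier. -/
theorem SameJet.mul_right {n : ℕ} {f g : FormalDiff} (h : SameJet n f g) (k : FormalDiff) :
    SameJet n (f * k) (g * k) ∧ (f * k).coeff (n + 1) - (g * k).coeff (n + 1) =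
      (f.coeff (n + 1) - g.coeff (n + 1)) * k.coeff 1 ^ (n + 1) := by
  obtain ⟨q, hq, hq0⟩ := h.exists_eq
  obtain ⟨u, hu⟩ := PowerSeries.X_dvd_iff.mpr k.constantCoeff_eq
  have hu0 : PowerSeries.constantCoeff u = k.coeff 1 := by
    rw [coeff, hu, mul_comm, PowerSeries.coeff_one_mul]
    simp
  have key : (f * k).toSeries - (g * k).toSeries =
      PowerSeries.X ^ (n + 1) * (u ^ (n + 1) * q.subst k.toSeries) := by
    rw [toSeries_mul, toSeries_mul, hq, PowerSeries.subst_add k.hasSubst,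
      PowerSeries.subst_mul k.hasSubst, PowerSeries.subst_pow k.hasSubst,
      PowerSeries.subst_X k.hasSubst, add_sub_cancel_left, ← mul_assoc, ← mul_pow, ← hu]
  have hc : PowerSeries.constantCoeff (q.subst k.toSeries) = PowerSeries.constantCoeff q := by
    obtain ⟨r, hr'⟩ := q.exists_eq_C_add_X_mul
    conv_lhs => rw [hr']
    rw [PowerSeries.subst_add k.hasSubst, PowerSeries.subst_mul k.hasSubst,
      PowerSeries.subst_X k.hasSubst, PowerSeries.C_subst]
    simp [k.constantCoeff_eq]
  refine ⟨sameJet_iff_dvd.mpr ⟨_, key⟩, ?_⟩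
  have := congrArg (PowerSeries.coeff (n + 1)) key
  rw [map_sub, PowerSeries.coeff_X_pow_mul', if_pos le_rfl, Nat.sub_self,
    PowerSeries.coeff_zero_eq_constantCoeff_apply, map_mul, map_pow, hc, hq0, hu0] at this
  rw [mul_comm]
  exact this

/-- The analogue of `SameJet.mul_right` for composition on the left, by Taylor expansion to first
order. -/
theorem SameJet.mul_left {n : ℕ} {f g : FormalDiff} (h : SameJet n f g) (k : FormalDiff) :
    SameJet n (k * f) (k * g) ∧ (k * f).coeff (n + 1) - (k * g).coeff (n + 1) =
      k.coeff 1 * (f.coeff (n + 1) - g.coeff (n + 1)) := by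
  obtain ⟨q, hq⟩ : ∃ q, k.toSeries = PowerSeries.C (k.coeff 1) * PowerSeries.X +
      PowerSeries.X ^ 2 * q := by
    obtain ⟨q, hq⟩ := (PowerSeries.X_pow_dvd_iff (n := 2)
      (φ := k.toSeries - PowerSeries.C (k.coeff 1) * PowerSeries.X)).mpr (by
        intro m hm
        have h0 := k.coeff_zero
        rw [coeff] at h0
        interval_cases m <;> simp [coeff, -PowerSeries.coeff_zero_eq_constantCoeff, h0])
    exact ⟨q, by rw [← hq]; ring⟩
  have hd := sameJet_iff_dvd.mp h
  have key : (PowerSeries.X : PowerSeries ℂ) ^ (n + 2) ∣ (k * f).toSeries - (k * g).toSeries -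
      PowerSeries.C (k.coeff 1) * (f.toSeries - g.toSeries) := by
    have hs (a : FormalDiff) : (k * a).toSeries = PowerSeries.C (k.coeff 1) * a.toSeries +
        a.toSeries ^ 2 * q.subst a.toSeries := by
      rw [toSeries_mul]
      conv_lhs => rw [hq]
      rw [PowerSeries.subst_add a.hasSubst, PowerSeries.subst_mul a.hasSubst,
        PowerSeries.subst_mul a.hasSubst, PowerSeries.subst_X a.hasSubst,
        PowerSeries.C_subst, PowerSeries.subst_pow a.hasSubst,
        PowerSeries.subst_X a.hasSubst]
    have hX (a : FormalDiff) : (PowerSeries.X : PowerSeries ℂ) ∣ a.toSeries :=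
      PowerSeries.X_dvd_iff.mpr a.constantCoeff_eq
    have e : (k * f).toSeries - (k * g).toSeries -
        PowerSeries.C (k.coeff 1) * (f.toSeries - g.toSeries) =
        (q.subst f.toSeries - q.subst g.toSeries) * (f.toSeries * f.toSeries) +
          (f.toSeries - g.toSeries) * (f.toSeries + g.toSeries) * q.subst g.toSeries := by
      rw [hs, hs]; ring
    rw [e, pow_succ _ (n + 1)]
    exact dvd_add
      (mul_dvd_mul (PowerSeries.X_pow_dvd_subst_sub_subst f.constantCoeff_eq g.constantCoeff_eq hd q)
        ((hX f).mul_right _))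
      ((mul_dvd_mul hd (dvd_add (hX f) (hX g))).mul_right _)
  rw [PowerSeries.X_pow_dvd_iff] at key
  have key' : ∀ i ≤ n + 1, (k * f).coeff i - (k * g).coeff i =
      k.coeff 1 * (f.coeff i - g.coeff i) := by
    intro i hi
    have := key i (by omega)
    rw [map_sub, map_sub, PowerSeries.coeff_C_mul, map_sub, sub_eq_zero] at this
    exact this
  refine ⟨fun i hi => ?_, key' _ le_rfl⟩
  rw [← sub_eq_zero, key' i (by omega), h i hi, sub_self, mul_zero]

theorem SameJet.mul {n : ℕ} {f g f' g' : FormalDiff} (h : SameJet n f g) (h' : SameJet n f' g') :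
    SameJet n (f * f') (g * g') :=
  (h.mul_right f').1.trans (h'.mul_left g).1

theorem SameJet.mul_coeff_succ {n : ℕ} {f g f' g' : FormalDiff} (h : SameJet n f g)
    (h' : SameJet n f' g') :
    (f * f').coeff (n + 1) - (g * g').coeff (n + 1) =
      (f.coeff (n + 1) - g.coeff (n + 1)) * f'.coeff 1 ^ (n + 1) +
        g.coeff 1 * (f'.coeff (n + 1) - g'.coeff (n + 1)) := by
  rw [← (h.mul_right f').2, ← (h'.mul_left g).2]
  ring

/-- The subgroup of the formal diffeomorphisms `x + O(x ^ (n + 1))`. -/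
noncomputable def Γ (n : ℕ) : Subgroup FormalDiff where
  carrier := {f | SameJet n f 1}
  one_mem' := SameJet.refl n 1
  mul_mem' {f g} hf hg := by simpa using SameJet.mul hf hg
  inv_mem' {f} hf := by
    have := (SameJet.mul_left (SameJet.symm hf) f⁻¹).1
    simpa using this

theorem mem_Γ {n : ℕ} {f : FormalDiff} : f ∈ Γ n ↔ SameJet n f 1 := Iff.rfl

theorem Γ_mono {m n : ℕ} (h : m ≤ n) {f : FormalDiff} (hf : f ∈ Γ n) : f ∈ Γ m :=
  SameJet.mono h hf

theorem mem_Γ_one {f : FormalDiff} : f ∈ Γ 1 ↔ f.coeff 1 = 1 := by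
  refine ⟨fun h => by rw [h 1 le_rfl, one_coeff_one], fun h i hi => ?_⟩
  interval_cases i <;> simp [h]

theorem coeff_one_of_mem {n : ℕ} (hn : 1 ≤ n) {f : FormalDiff} (hf : f ∈ Γ n) : f.coeff 1 = 1 :=
  mem_Γ_one.mp (Γ_mono hn hf)

theorem mem_Γ_succ {n : ℕ} (hn : 1 ≤ n) {f : FormalDiff} :
    f ∈ Γ (n + 1) ↔ f ∈ Γ n ∧ f.coeff (n + 1) = 0 := by
  refine ⟨fun h => ⟨Γ_mono n.le_succ h, ?_⟩, fun h => SameJet.succ h.1 ?_⟩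
  · rw [h _ le_rfl, one_coeff_of_ne (by omega)]
  · rw [h.2, one_coeff_of_ne (by omega)]

theorem eq_one_of_forall_mem {f : FormalDiff} (h : ∀ n, 1 ≤ n → f ∈ Γ n) : f = 1 :=
  eq_of_forall_sameJet h

theorem sameJet_iff_inv_mul_mem {n : ℕ} {f g : FormalDiff} : SameJet n f g ↔ g⁻¹ * f ∈ Γ n := by
  refine ⟨fun h => ?_, fun h => ?_⟩
  · simpa [mem_Γ] using (h.mul_left g⁻¹).1
  · simpa using (SameJet.mul_left h g).1

theorem mul_coeff_succ {n : ℕ} (hn : 1 ≤ n) {f g : FormalDiff} (hf : f ∈ Γ n) (hg : g ∈ Γ n) :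
    (f * g).coeff (n + 1) = f.coeff (n + 1) + g.coeff (n + 1) := by
  have h := SameJet.mul_coeff_succ hf hg
  rw [coeff_one_of_mem hn hg, mul_one, one_coeff_of_ne (by omega), one_coeff_one] at h
  linear_combination h

theorem pow_coeff_succ_sub {n : ℕ} {f g : FormalDiff} (hf : f ∈ Γ 1) (hg : g ∈ Γ 1)
    (h : SameJet n f g) (e : ℕ) : SameJet n (f ^ e) (g ^ e) ∧
    (f ^ e).coeff (n + 1) - (g ^ e).coeff (n + 1) = e * (f.coeff (n + 1) - g.coeff (n + 1)) := by
  induction e with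
  | zero => simp [SameJet.refl]
  | succ e ih =>
    rw [pow_succ, pow_succ]
    refine ⟨ih.1.mul h, ?_⟩
    rw [ih.1.mul_coeff_succ h, ih.2, mem_Γ_one.mp hf, mem_Γ_one.mp (pow_mem hg e)]
    push_cast
    ring

theorem pow_coeff_succ {n : ℕ} (hn : 1 ≤ n) {f : FormalDiff} (hf : f ∈ Γ n) (e : ℕ) :
    (f ^ e).coeff (n + 1) = e * f.coeff (n + 1) := by
  have := (pow_coeff_succ_sub (Γ_mono hn hf) (one_mem _) hf e).2
  rwa [one_pow, one_coeff_of_ne (by omega), sub_zero, sub_zero] at this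

/-- The product of `x + a x ^ (k + 1) + ⋯` and `x + b x ^ (l + 1) + ⋯`, up to degree
`k + l + 1`. -/
theorem mul_toSeries_of_mem {k l : ℕ} (hk : 1 ≤ k) (hl : 1 ≤ l) {f g : FormalDiff} (hf : f ∈ Γ k)
    (hg : g ∈ Γ l) : (PowerSeries.X : PowerSeries ℂ) ^ (k + l + 2) ∣ (f * g).toSeries -
      (f.toSeries + g.toSeries - PowerSeries.X + PowerSeries.C ((k + 1) * f.coeff (k + 1) *
        g.coeff (l + 1)) * PowerSeries.X ^ (k + l + 1)) := by
  obtain ⟨p, hp, hp0⟩ := SameJet.exists_eq hf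
  obtain ⟨q, hq, hq0⟩ := SameJet.exists_eq hg
  rw [one_coeff_of_ne (by omega), sub_zero] at hp0 hq0
  rw [toSeries_one] at hp hq
  have hs : (f * g).toSeries = g.toSeries + g.toSeries ^ (k + 1) * p.subst g.toSeries := by
    rw [toSeries_mul]
    conv_lhs => rw [hp]
    rw [PowerSeries.subst_add g.hasSubst, PowerSeries.subst_mul g.hasSubst,
      PowerSeries.subst_pow g.hasSubst, PowerSeries.subst_X g.hasSubst]
  obtain ⟨r, hr⟩ := PowerSeries.X_pow_dvd_subst_sub_subst (n := l + 1) g.constantCoeff_eq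
    (g := PowerSeries.X) (by simp) ⟨q, by rw [hq]; ring⟩ p
  rw [← PowerSeries.map_algebraMap_eq_subst_X] at hr
  have hr' : p.subst g.toSeries = p + PowerSeries.X ^ (l + 1) * r := by
    rw [← hr]
    have : PowerSeries.map (algebraMap ℂ ℂ) p = p := by ext; simp
    rw [this]; ring
  obtain ⟨w, hw⟩ := (q * p).exists_eq_C_add_X_mul
  rw [map_mul, hq0, hp0] at hw
  obtain ⟨l, rfl⟩ := Nat.exists_eq_add_of_le' hl
  -- The binomial expansion of `(g / X) ^ (k + 1)`, up to the square of `X ^ l * q`.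
  obtain ⟨s, hs'⟩ := Polynomial.powAddExpansion (1 : PowerSeries ℂ)
    (PowerSeries.X ^ (l + 1) * q) (k + 1)
  have hg' : g.toSeries ^ (k + 1) = PowerSeries.X ^ (k + 1) * (1 + (k + 1 : PowerSeries ℂ) *
      (PowerSeries.X ^ (l + 1) * q) + s * (PowerSeries.X ^ (l + 1) * q) ^ 2) := by
    rw [show g.toSeries = PowerSeries.X * (1 + PowerSeries.X ^ (l + 1) * q) by rw [hq]; ring,
      mul_pow, hs']
    push_cast
    ring
  refine ⟨(1 + (k + 1 : PowerSeries ℂ) * (PowerSeries.X ^ (l + 1) * q) +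
    s * (PowerSeries.X ^ (l + 1) * q) ^ 2) * r + (k + 1 : PowerSeries ℂ) * w +
      s * PowerSeries.X ^ l * q ^ 2 * p, ?_⟩
  have hC : PowerSeries.C ((k + 1) * f.coeff (k + 1) * g.coeff (l + 1 + 1)) =
      (k + 1 : PowerSeries ℂ) * (q * p - PowerSeries.X * w) := by
    rw [hw, add_sub_cancel_right]
    simp only [map_mul, map_add, map_natCast, map_one]
    ring
  rw [hs, hg', hr', hC, hp]
  ring

/-- The commutation defect of `x + a x ^ (k + 1) + ⋯` and `x + b x ^ (l + 1) + ⋯` is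
`(k - l) a b x ^ (k + l + 1) + ⋯`, the bracket of the corresponding vector fields. -/
theorem mul_coeff_sub_mul_coeff {k l : ℕ} (hk : 1 ≤ k) (hl : 1 ≤ l) {f g : FormalDiff}
    (hf : f ∈ Γ k) (hg : g ∈ Γ l) : SameJet (k + l) (f * g) (g * f) ∧
      (f * g).coeff (k + l + 1) - (g * f).coeff (k + l + 1) =
        (k - l) * (f.coeff (k + 1) * g.coeff (l + 1)) := by
  have h₁ := mul_toSeries_of_mem hk hl hf hg
  have h₂ := mul_toSeries_of_mem hl hk hg hf
  rw [add_comm l k] at h₂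
  have h := dvd_sub h₁ h₂
  have e : (f * g).toSeries - (f.toSeries + g.toSeries - PowerSeries.X +
      PowerSeries.C ((k + 1) * f.coeff (k + 1) * g.coeff (l + 1)) *
        PowerSeries.X ^ (k + l + 1)) - ((g * f).toSeries -
      (g.toSeries + f.toSeries - PowerSeries.X + PowerSeries.C ((l + 1) * g.coeff (l + 1) *
        f.coeff (k + 1)) * PowerSeries.X ^ (k + l + 1))) =
      (f * g).toSeries - (g * f).toSeries - PowerSeries.C ((k - l) *
        (f.coeff (k + 1) * g.coeff (l + 1))) * PowerSeries.X ^ (k + l + 1) := by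
    rw [show ((k : ℂ) - l) * (f.coeff (k + 1) * g.coeff (l + 1)) =
      (k + 1) * f.coeff (k + 1) * g.coeff (l + 1) - (l + 1) * g.coeff (l + 1) * f.coeff (k + 1)
      by ring, map_sub]
    ring
  rw [e, PowerSeries.X_pow_dvd_iff] at h
  have h' : ∀ i ≤ k + l + 1, (f * g).coeff i - (g * f).coeff i =
      if i = k + l + 1 then (k - l) * (f.coeff (k + 1) * g.coeff (l + 1)) else 0 := by
    intro i hi
    have := h i (by omega)
    rw [map_sub, map_sub, PowerSeries.coeff_C_mul, PowerSeries.coeff_X_pow, sub_eq_zero] at this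
    simpa [coeff] using this
  refine ⟨fun i hi => ?_, by simpa using h' _ le_rfl⟩
  have := h' i (by omega)
  rwa [if_neg (by omega), sub_eq_zero] at this

/-! ### Linear maps and the homographies `x / (1 - t x)` -/

/-- The linear maps `x ↦ a x`, as a homomorphism. -/
noncomputable def lin : ℂˣ →* FormalDiff where
  toFun a :=
    { toSeries := (a : ℂ) • PowerSeries.X
      constantCoeff_eq := by simp
      coeff_one_ne := by simp }
  map_one' := by
    ext1
    simp [toSeries_one]
  map_mul' a b := by
    ext1
    change _ = PowerSeries.subst _ _
    rw [PowerSeries.subst_smul (PowerSeries.HasSubst.smul_X' _),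
      PowerSeries.subst_X (PowerSeries.HasSubst.smul_X' _), smul_smul]
    rfl

theorem lin_toSeries (a : ℂˣ) : (lin a).toSeries = (a : ℂ) • PowerSeries.X := rfl

theorem lin_coeff (a : ℂˣ) (n : ℕ) : (lin a).coeff n = if n = 1 then (a : ℂ) else 0 := by
  simp [coeff, lin_toSeries, PowerSeries.coeff_X]

@[simp] theorem lin_coeff_one (a : ℂˣ) : (lin a).coeff 1 = a := by simp [lin_coeff]

theorem lin_injective : Function.Injective lin := fun a b h => by
  have := congrArg (fun f => coeff f 1) h
  simpa [Units.ext_iff] using this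

theorem lin_mul_coeff (a : ℂˣ) (f : FormalDiff) (n : ℕ) :
    (lin a * f).coeff n = a * f.coeff n := by
  rw [coeff, toSeries_mul, lin_toSeries, PowerSeries.subst_smul f.hasSubst,
    PowerSeries.subst_X f.hasSubst]
  simp [coeff]

theorem mul_lin_coeff (f : FormalDiff) (a : ℂˣ) (n : ℕ) :
    (f * lin a).coeff n = (a : ℂ) ^ n * f.coeff n := by
  rw [coeff, toSeries_mul, lin_toSeries, ← PowerSeries.rescale_eq_subst,
    PowerSeries.coeff_rescale]
  rfl

/-- The conjugate `x ↦ a⁻¹ f(a x)` of `f` by a linear map. -/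
noncomputable def scale (a : ℂˣ) (f : FormalDiff) : FormalDiff := (lin a)⁻¹ * f * lin a

theorem scale_coeff (a : ℂˣ) (f : FormalDiff) (n : ℕ) :
    (scale a f).coeff (n + 1) = (a : ℂ) ^ n * f.coeff (n + 1) := by
  rw [scale, mul_lin_coeff, ← map_inv, lin_mul_coeff, pow_succ]
  have := a.ne_zero
  simp only [Units.val_inv_eq_inv_val]
  field_simp

theorem scale_mem_Γ {n : ℕ} {f : FormalDiff} (hf : f ∈ Γ n) (a : ℂˣ) : scale a f ∈ Γ n := by
  intro i hi
  rcases i with _ | i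
  · simp
  · rw [scale_coeff, hf _ hi]
    rcases i with _ | i
    · simp
    · rw [one_coeff_of_ne (by omega), mul_zero]

theorem SameJet.scale {n : ℕ} {f g : FormalDiff} (h : SameJet n f g) (a : ℂˣ) :
    SameJet n (scale a f) (FormalDiff.scale a g) :=
  ((SameJet.refl n _).mul h).mul (SameJet.refl n _)

theorem scale_one_right (a : ℂˣ) : scale a 1 = 1 := by simp [scale]

theorem scale_mul (a : ℂˣ) (f g : FormalDiff) : scale a (f * g) = scale a f * scale a g := by
  simp [scale, mul_assoc]

theorem scale_pow (a : ℂˣ) (f : FormalDiff) (n : ℕ) : scale a (f ^ n) = scale a f ^ n := by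
  induction n with
  | zero => simp [scale_one_right]
  | succ n ih => rw [pow_succ, pow_succ, scale_mul, ih]

theorem scale_scale (a b : ℂˣ) (f : FormalDiff) : scale a (scale b f) = scale (b * a) f := by
  simp [scale, mul_assoc]

theorem map_scale (σ : MulAut FormalDiff) {a b : ℂˣ} (h : σ (lin a) = lin b) (f : FormalDiff) :
    σ (scale a f) = scale b (σ f) := by
  simp [scale, h]

/-- A formal diffeomorphism commuting with a non-periodic linear map is linear. -/
theorem eq_lin_of_commute {μ : ℂˣ} (hμ : ∀ n : ℕ, 1 ≤ n → μ ^ n ≠ 1) {f : FormalDiff}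
    (h : Commute f (lin μ)) : ∃ a : ℂˣ, f = lin a := by
  refine ⟨Units.mk0 _ f.coeff_one_ne_zero, ext_coeff fun n => ?_⟩
  rw [lin_coeff]
  split_ifs with hn
  · rw [hn, Units.val_mk0]
  rcases n with _ | n
  · simp
  have h' := congrArg (fun f => coeff f (n + 1)) h.eq
  simp only [lin_mul_coeff, mul_lin_coeff] at h'
  have h₂ : ((μ : ℂ) ^ n - 1) * f.coeff (n + 1) = 0 :=
    mul_left_cancel₀ μ.ne_zero (by linear_combination h')
  refine (mul_eq_zero.mp h₂).resolve_left fun h₃ => hμ n (by omega) ?_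
  rw [sub_eq_zero] at h₃
  ext
  simpa using h₃

/-- The homography `x / (1 - t x)`. -/
noncomputable def parabolic (t : ℂ) : FormalDiff :=
  ofCoeff (fun n => if n = 0 then 0 else t ^ (n - 1)) (by simp) (by simp)

@[simp] theorem parabolic_coeff_succ (t : ℂ) (n : ℕ) : (parabolic t).coeff (n + 1) = t ^ n := by
  simp [parabolic]

theorem parabolic_mem (t : ℂ) : parabolic t ∈ Γ 1 := 
  mem_Γ_one.mpr ((parabolic_coeff_succ t 0).trans (pow_zero t))

theorem parabolic_injective : Function.Injective parabolic := fun s t h => by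
  rw [← pow_one s, ← pow_one t, ← parabolic_coeff_succ, h, parabolic_coeff_succ]

theorem parabolic_zero : parabolic 0 = 1 := by
  refine ext_coeff fun n => ?_
  rcases n with _ | _ | n
  · simp
  · simp
  · rw [parabolic_coeff_succ, one_coeff_of_ne (by omega)]
    simp

theorem parabolic_toSeries_mul (t : ℂ) :
    (parabolic t).toSeries * (1 - PowerSeries.C t * PowerSeries.X) = PowerSeries.X := by
  ext n
  rw [mul_sub, mul_one, mul_left_comm, map_sub, PowerSeries.coeff_C_mul]
  rcases n with _ | _ | n
  · rw [PowerSeries.coeff_zero_mul_X, mul_zero, PowerSeries.coeff_zero_X]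
    simpa [coeff] using (parabolic t).coeff_zero
  · rw [PowerSeries.coeff_succ_mul_X]
    have h0 := (parabolic t).coeff_zero
    have h1 := parabolic_coeff_succ t 0
    simp only [coeff] at h0 h1
    rw [h0, h1]
    simp
  · rw [PowerSeries.coeff_succ_mul_X]
    have h0 := parabolic_coeff_succ t n
    have h1 := parabolic_coeff_succ t (n + 1)
    simp only [coeff] at h0 h1
    rw [h0, h1, PowerSeries.coeff_X, if_neg (by omega)]
    ring

theorem parabolic_add (s t : ℂ) : parabolic (s + t) = parabolic s * parabolic t := by
  ext1
  have hne : (1 - PowerSeries.C (s + t) * PowerSeries.X : PowerSeries ℂ) ≠ 0 := fun h => by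
    have := congrArg PowerSeries.constantCoeff h
    simp at this
  refine mul_right_cancel₀ hne ?_
  rw [parabolic_toSeries_mul, toSeries_mul]
  have hs := congrArg (PowerSeries.subst (parabolic t).toSeries) (parabolic_toSeries_mul s)
  have ht := parabolic_toSeries_mul t
  have hsub := (parabolic t).hasSubst
  rw [PowerSeries.subst_mul hsub, PowerSeries.subst_X hsub, ← PowerSeries.coe_substAlgHom hsub,
    map_sub, map_one, map_mul, PowerSeries.coe_substAlgHom hsub, PowerSeries.C_subst,
    PowerSeries.subst_X hsub] at hs
  rw [map_add]
  linear_combination (-(1 - PowerSeries.C t * PowerSeries.X)) * hs - (PowerSeries.C s *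
    (PowerSeries.subst (parabolic t).toSeries (parabolic s).toSeries) + 1) * ht

theorem scale_parabolic (a : ℂˣ) (t : ℂ) : scale a (parabolic t) = parabolic (a * t) := by
  refine ext_coeff fun n => ?_
  rcases n with _ | n
  · simp
  · rw [scale_coeff, parabolic_coeff_succ, parabolic_coeff_succ, mul_pow]

/-! ### The equation `h ^ e ∘ g = μ⁻¹ h(μ x)` -/

/-- Completeness of the group for the filtration `Γ`. -/
theorem exists_sameJet_of_seq (s : ℕ → FormalDiff) (hs : ∀ n, SameJet n (s (n + 1)) (s n)) :
    ∃ f, ∀ n, SameJet n f (s n) := by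
  refine ⟨ofCoeff (fun n => (s n).coeff n) (coeff_zero _) (coeff_one_ne_zero _), fun n i hi => ?_⟩
  rw [ofCoeff_coeff]
  induction n, hi using Nat.le_induction with
  | base => rfl
  | succ m hm ih => exact ih.trans (hs m i hm).symm

/-- If `μ ^ m ≠ e` for `m ≥ k`, then `h ^ e * g = scale μ h` has a solution `h` in `Γ k` for each
`g` in `Γ k`: the coefficient of degree `m + 1` of the equation reads
`(μ ^ m - e) h_{m + 1} = ⋯`, where the right-hand side depends on lower coefficients of `h`. -/
theorem exists_pow_mul_eq_scale {k e : ℕ} (hk : 1 ≤ k) {μ : ℂˣ}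
    (hμ : ∀ m, k ≤ m → (μ : ℂ) ^ m ≠ e) {g : FormalDiff} (hg : g ∈ Γ k) :
    ∃ h ∈ Γ k, h ^ e * g = scale μ h := by
  let P (n : ℕ) (h : FormalDiff) : Prop := h ∈ Γ k ∧ SameJet n (h ^ e * g) (scale μ h)
  have step : ∀ n h, P (k + n) h → ∃ h', SameJet (k + n) h' h ∧ P (k + n + 1) h' := by
    rintro n h ⟨hh, hj⟩
    set N := k + n with hN
    set c := ((h ^ e * g).coeff (N + 1) - (scale μ h).coeff (N + 1)) / ((μ : ℂ) ^ N - e) with hc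
    have hne : (μ : ℂ) ^ N - e ≠ 0 := sub_ne_zero.mpr (hμ N (by omega))
    let h' : FormalDiff := ofCoeff (fun i => if i = N + 1 then h.coeff (N + 1) + c else h.coeff i)
      (by simp) (by
        simpa [show N ≠ 0 by omega] using h.coeff_one_ne_zero)
    have hjet : SameJet N h' h := fun i hi => by simp [h', show i ≠ N + 1 by omega]
    have hlast : h'.coeff (N + 1) - h.coeff (N + 1) = c := by simp [h']
    have hh' : h' ∈ Γ k := (hjet.mono (by omega)).trans hh
    refine ⟨h', hjet, hh', SameJet.succ ?_ ?_⟩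
    · exact ((pow_coeff_succ_sub (Γ_mono hk hh') (Γ_mono hk hh) hjet e).1.mul
        (SameJet.refl N g)).trans (hj.trans (hjet.symm.scale μ))
    · have hp := pow_coeff_succ_sub (Γ_mono hk hh') (Γ_mono hk hh) hjet e
      have h₁ := (hp.1.mul_right g).2
      rw [hp.2, hlast, coeff_one_of_mem hk hg, one_pow, mul_one] at h₁
      have h₂ := scale_coeff μ h' N
      have h₃ := scale_coeff μ h N
      have h₄ : c * ((μ : ℂ) ^ N - e) = _ := div_mul_cancel₀ _ hne
      linear_combination h₁ - h₂ + h₃ - h₄ - (μ : ℂ) ^ N * hlast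
  choose! next hnext using step
  let s : ∀ n, {h // P (k + n) h} := fun n => Nat.rec
    ⟨1, one_mem _, by rw [one_pow, one_mul, scale_one_right]; exact hg⟩
    (fun n h => ⟨next n h.1, (hnext n h.1 h.2).2⟩) n
  obtain ⟨f, hf⟩ := exists_sameJet_of_seq (fun n => (s n).1) fun n =>
    ((hnext n (s n).1 (s n).2).1).mono (by omega)
  refine ⟨f, (hf k).trans (s k).2.1, eq_of_forall_sameJet fun n hn => ?_⟩
  have h1 : f ∈ Γ 1 := (hf 1).trans (Γ_mono hk (s 1).2.1)
  exact ((pow_coeff_succ_sub h1 (Γ_mono hk (s n).2.1) (hf n) e).1.mul (SameJet.refl n g)).trans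
    (((s n).2.2.mono (by omega)).trans ((hf n).symm.scale μ))

/-- If `μ ^ m ≠ e` for `m ≠ k`, the solutions of `f ^ e = scale μ f` tangent to the identity are
determined by their coefficient of degree `k + 1`. -/
theorem eq_of_pow_eq_scale {k e : ℕ} {μ : ℂˣ} (hμ : ∀ m, m ≠ k → (μ : ℂ) ^ m ≠ e)
    {f g : FormalDiff} (hf : f ∈ Γ 1) (hg : g ∈ Γ 1) (hfe : f ^ e = scale μ f)
    (hge : g ^ e = scale μ g) (h : f.coeff (k + 1) = g.coeff (k + 1)) : f = g := by
  refine eq_of_forall_sameJet fun n hn => ?_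
  induction n, hn using Nat.le_induction with
  | base => exact SameJet.trans hf (SameJet.symm hg)
  | succ n hn ih =>
    refine ih.succ ?_
    rcases eq_or_ne n k with rfl | hnk
    · exact h
    have h' := (pow_coeff_succ_sub hf hg ih e).2
    rw [hfe, hge, scale_coeff, scale_coeff] at h'
    have h₂ : ((μ : ℂ) ^ n - e) * (f.coeff (n + 1) - g.coeff (n + 1)) = 0 := by
      linear_combination h'
    exact sub_eq_zero.mp ((mul_eq_zero.mp h₂).resolve_left (sub_ne_zero.mpr (hμ n hnk)))

/-- Formal linearization. -/
theorem exists_conj_eq_lin {μ : ℂˣ} (hμ : ∀ n : ℕ, 1 ≤ n → μ ^ n ≠ 1) {f : FormalDiff}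
    (hf : f.coeff 1 = μ) : ∃ h ∈ Γ 1, h * f * h⁻¹ = lin μ := by
  obtain ⟨h, hh, e⟩ := exists_pow_mul_eq_scale (e := 1) (g := f⁻¹ * lin μ) le_rfl
    (fun m hm h => hμ m hm (by ext; simpa using h)) (mem_Γ_one.mpr (by
      have := mul_coeff_one f⁻¹ f
      rw [inv_mul_cancel, one_coeff_one, hf] at this
      rw [mul_coeff_one, lin_coeff_one, this]))
  refine ⟨h, hh, ?_⟩
  rw [pow_one, scale, ← mul_assoc, mul_left_inj] at e
  rw [← inv_inj]
  simpa [mul_assoc] using congrArg (· * h⁻¹) e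

/-! ### Normalization of an automorphism on the affine group -/

/-- The number `2` as a unit. -/
noncomputable def two : ℂˣ := Units.mk0 2 two_ne_zero

@[simp] theorem coe_two : (two : ℂ) = 2 := rfl

theorem two_pow_ne_one (n : ℕ) (hn : 1 ≤ n) : two ^ n ≠ 1 := fun h => by
  have := congrArg (fun a : ℂˣ => (a : ℂ)) h
  rw [Units.val_pow_eq_pow_val, coe_two, Units.val_one] at this
  exact (Nat.one_lt_two_pow (n := n) (by omega)).ne' (by exact_mod_cast this)

/-- Automorphisms preserve `Γ 1`, whose elements are the commutators. -/
theorem map_mem_Γ_one (σ : MulAut FormalDiff) {f : FormalDiff} (hf : f ∈ Γ 1) : σ f ∈ Γ 1 := by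
  obtain ⟨h, -, e⟩ := exists_conj_eq_lin two_pow_ne_one (f := f * lin two)
    (by rw [mul_coeff_one, mem_Γ_one.mp hf, one_mul, lin_coeff_one])
  have e' : f = h⁻¹ * lin two * h * (lin two)⁻¹ := by
    calc f = h⁻¹ * (h * (f * lin two) * h⁻¹) * h * (lin two)⁻¹ := by group
      _ = _ := by rw [e]
  rw [mem_Γ_one, ← multiplier_apply, e']
  simp only [map_mul]
  rw [mul_right_comm (multiplier (σ h⁻¹)), mul_assoc, ← map_mul, ← map_mul, ← map_mul, ← map_mul]
  simp

theorem map_mem_Γ_one_iff (σ : MulAut FormalDiff) {f : FormalDiff} : σ f ∈ Γ 1 ↔ f ∈ Γ 1 :=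
  ⟨fun h => by simpa using map_mem_Γ_one σ⁻¹ h, map_mem_Γ_one σ⟩

/-- Up to an inner automorphism, `2 x` is sent to a linear map: the multiplier of its image is not a
root of unity because automorphisms preserve `Γ 1`, so that the image is linearizable. -/
theorem exists_conj_map_lin_two (σ : MulAut FormalDiff) : ∃ (φ : FormalDiff) (μ : ℂˣ),
    (∀ n : ℕ, 1 ≤ n → μ ^ n ≠ 1) ∧ (MulAut.conj φ * σ) (lin two) = lin μ := by
  let μ : ℂˣ := Units.mk0 _ (σ (lin two)).coeff_one_ne_zero
  have hμ : ∀ n : ℕ, 1 ≤ n → μ ^ n ≠ 1 := fun n hn h => by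
    have h₁ : σ (lin (two ^ n)) ∈ Γ 1 := by
      rw [mem_Γ_one, map_pow, map_pow, ← multiplier_apply, map_pow, multiplier_apply]
      exact congrArg (fun a : ℂˣ => (a : ℂ)) h
    rw [map_mem_Γ_one_iff, mem_Γ_one, lin_coeff_one] at h₁
    exact two_pow_ne_one n hn (by ext; exact h₁)
  obtain ⟨h, -, e⟩ := exists_conj_eq_lin hμ (f := σ (lin two)) rfl
  exact ⟨h, μ, hμ, by simpa using e⟩

/-- A nontrivial `f` in `Γ 1` is `x + a x ^ (k + 1) + ⋯` with `a ≠ 0`. -/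
theorem exists_order {f : FormalDiff} (hf : f ∈ Γ 1) (hne : f ≠ 1) :
    ∃ k, 1 ≤ k ∧ f ∈ Γ k ∧ f.coeff (k + 1) ≠ 0 := by
  by_contra! h
  refine hne (eq_one_of_forall_mem fun n hn => ?_)
  induction n, hn using Nat.le_induction with
  | base => exact hf
  | succ n hn ih => exact (mem_Γ_succ hn).mpr ⟨ih, h n hn ih⟩

theorem parabolic_sq (t : ℂ) : parabolic t ^ 2 = scale two (parabolic t) := by
  rw [scale_parabolic, pow_two, ← parabolic_add, coe_two, two_mul]

theorem two_pow_ne_two {m : ℕ} (hm : m ≠ 1) : ((two : ℂˣ) : ℂ) ^ m ≠ (2 : ℕ) := fun h => by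
  rw [coe_two] at h
  have h' : 2 ^ m = 2 ^ 1 := by exact_mod_cast h
  exact hm (Nat.pow_right_injective le_rfl h')

/-- An automorphism sending linear maps to linear maps fixes `2 x` and sends `x / (1 - x)` to a
homography, whose order of contact with the identity is found by conjugating it with the image
of a rotation. -/
theorem map_parabolic_one (σ : MulAut FormalDiff) (χ : ℂˣ → ℂˣ)
    (hχ : ∀ a, σ (lin a) = lin (χ a)) (hμ : ∀ n : ℕ, 1 ≤ n → χ two ^ n ≠ 1) :
    χ two = two ∧ ∃ a : ℂˣ, σ (parabolic 1) = parabolic a := by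
  set g := σ (parabolic 1) with hg
  have hg1 : g ∈ Γ 1 := map_mem_Γ_one σ (parabolic_mem 1)
  have hne : g ≠ 1 := fun h => by
    rw [hg, map_eq_one_iff σ σ.injective, ← parabolic_zero] at h
    exact one_ne_zero (parabolic_injective h)
  obtain ⟨k, hk, hgk, ha⟩ := exists_order hg1 hne
  have hsq : g ^ 2 = scale (χ two) g := by
    rw [hg, ← map_pow, parabolic_sq, map_scale σ (hχ two)]
  have hμk : (χ two : ℂ) ^ k = 2 := by
    have := congrArg (fun f => coeff f (k + 1)) hsq
    simp only [pow_coeff_succ hk hgk, scale_coeff] at this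
    exact mul_right_cancel₀ ha (by simpa using this.symm)
  have hμm : ∀ m, m ≠ k → (χ two : ℂ) ^ m ≠ (2 : ℕ) := fun m hm h => by
    have hinj : Function.Injective (fun n : ℕ => χ two ^ n) :=
      injective_pow_iff_not_isOfFinOrder.mpr fun hfin => by
        obtain ⟨n, hn, e⟩ := isOfFinOrder_iff_pow_eq_one.mp hfin
        exact hμ n hn e
    refine hm (hinj (Units.ext ?_))
    simpa [hμk] using h
  have hk1 : k = 1 := by
    have hprim := Complex.isPrimitiveRoot_exp k (by omega)
    set ζ : ℂˣ := (hprim.isUnit (by omega)).unit with hζ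
    have hζk : ζ ^ k = 1 := by
      ext
      exact hprim.pow_eq_one
    have hω : χ ζ ^ k = 1 := lin_injective (by rw [map_pow, ← hχ, ← map_pow, ← map_pow, hζk]; simp)
    have hfix : scale (χ ζ) g = g := by
      refine eq_of_pow_eq_scale hμm (scale_mem_Γ hg1 _) hg1 ?_ hsq ?_
      · rw [← scale_pow, hsq, scale_scale, scale_scale, mul_comm]
      · rw [scale_coeff, ← Units.val_pow_eq_pow_val, hω, Units.val_one, one_mul]
    rw [hg, ← map_scale σ (hχ ζ), σ.injective.eq_iff, scale_parabolic, mul_one] at hfix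
    have := parabolic_injective hfix
    rw [show (ζ : ℂ) = Complex.exp (2 * Real.pi * Complex.I / k) from rfl] at this
    rw [this] at hprim
    exact hprim.unique IsPrimitiveRoot.one
  subst hk1
  have h2 : χ two = two := by
    ext
    simpa using hμk
  refine ⟨h2, Units.mk0 _ ha, eq_of_pow_eq_scale (k := 1) (e := 2) (μ := two)
    (fun m hm => two_pow_ne_two hm) hg1 (parabolic_mem _) (h2 ▸ hsq) (parabolic_sq _) ?_⟩
  rw [parabolic_coeff_succ, pow_one, Units.val_mk0]

/-- Up to an inner automorphism, an automorphism acts on the affine group of the linear maps and of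
the homographies `x / (1 - t x)` as a field automorphism. -/
theorem exists_conj_map_affine (σ : MulAut FormalDiff) : ∃ (φ : FormalDiff) (τ : RingAut ℂ),
    (∀ a : ℂˣ, (MulAut.conj φ * σ) (lin a) = lin (Units.map (τ : ℂ →* ℂ) a)) ∧
      (MulAut.conj φ * σ) (parabolic 1) = parabolic 1 := by
  obtain ⟨φ, μ, hμ, hσ⟩ := exists_conj_map_lin_two σ
  set σ₁ := MulAut.conj φ * σ with hσ₁
  have hlin : ∀ a : ℂˣ, ∃ b : ℂˣ, σ₁ (lin a) = lin b := fun a =>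
    eq_lin_of_commute hμ (by
      rw [← hσ]
      exact ((Commute.all a two).map lin).map σ₁)
  choose χ hχ using hlin
  have hχ2 : χ two = μ := lin_injective (by rw [← hχ, hσ])
  obtain ⟨h2, a, ha⟩ := map_parabolic_one σ₁ χ hχ (by rwa [hχ2])
  set σ₂ := MulAut.conj (lin a) * σ₁ with hσ₂
  have hσ₂' : ∀ f, σ₂ f = lin a * σ₁ f * (lin a)⁻¹ := fun f => rfl
  have hlin₂ : ∀ b, σ₂ (lin b) = lin (χ b) := fun b => by
    rw [hσ₂', hχ, ← map_mul, mul_comm, map_mul, mul_inv_cancel_right]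
  have hpar₂ : σ₂ (parabolic 1) = parabolic 1 := by
    have : parabolic a = (lin a)⁻¹ * parabolic 1 * lin a := by
      rw [← scale, scale_parabolic, mul_one]
    rw [hσ₂', ha, this]
    group
  have hpar : ∀ b : ℂˣ, σ₂ (parabolic b) = parabolic (χ b) := fun b => by
    rw [← mul_one (b : ℂ), ← scale_parabolic, map_scale σ₂ (hlin₂ b), hpar₂, scale_parabolic,
      mul_one]
  have hχmul : ∀ b c, χ (b * c) = χ b * χ c := fun b c => lin_injective (by
    rw [← hlin₂, map_mul, map_mul, hlin₂, hlin₂, map_mul])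
  have hχone : χ 1 = 1 := lin_injective (by rw [← hlin₂]; simp)
  -- The extension of `χ` by `0` is a ring homomorphism, additivity being read on the homographies.
  let t : ℂ → ℂ := fun x => if hx : x = 0 then 0 else χ (Units.mk0 x hx)
  have ht0 : t 0 = 0 := by simp [t]
  have htu : ∀ b : ℂˣ, t b = χ b := fun b => by simp [t]
  have htp : ∀ x, σ₂ (parabolic x) = parabolic (t x) := fun x => by
    rcases eq_or_ne x 0 with rfl | hx
    · rw [ht0, parabolic_zero, map_one]
    · have := hpar (Units.mk0 x hx)
      rwa [← htu, Units.val_mk0] at this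
  let τ₀ : ℂ →+* ℂ :=
    { toFun := t
      map_zero' := ht0
      map_one' := by rw [← Units.val_one, htu, hχone]
      map_add' := fun x y => parabolic_injective (by
        rw [← htp, parabolic_add, map_mul, htp, htp, parabolic_add])
      map_mul' := fun x y => by
        rcases eq_or_ne x 0 with rfl | hx
        · simp [ht0]
        rcases eq_or_ne y 0 with rfl | hy
        · simp [ht0]
        have := congrArg (fun a : ℂˣ => (a : ℂ)) (hχmul (Units.mk0 x hx) (Units.mk0 y hy))
        rw [Units.val_mul, ← htu, ← htu, ← htu] at this
        simpa using this }
  have hsurj : Function.Surjective τ₀ := fun y => by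
    rcases eq_or_ne y 0 with rfl | hy
    · exact ⟨0, ht0⟩
    have hinv : σ₂⁻¹ (lin two) = lin two := by
      rw [MulAut.inv_apply, MulEquiv.symm_apply_eq, hlin₂, h2]
    obtain ⟨b, hb⟩ := eq_lin_of_commute two_pow_ne_one (f := σ₂⁻¹ (lin (Units.mk0 y hy))) (by
      conv_rhs => rw [← hinv]
      exact ((Commute.all _ two).map lin).map σ₂⁻¹)
    refine ⟨b, (htu b).trans ?_⟩
    rw [MulAut.inv_apply, MulEquiv.symm_apply_eq, hlin₂] at hb
    rw [← lin_injective hb, Units.val_mk0]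
  refine ⟨lin a * φ, RingEquiv.ofBijective τ₀ ⟨τ₀.injective, hsurj⟩, fun b => ?_, ?_⟩
  · rw [map_mul, mul_assoc]
    refine (hlin₂ b).trans (congrArg lin (Units.ext ?_))
    exact (htu b).symm
  · rw [map_mul, mul_assoc]
    exact hpar₂

/-! ### Rigidity of an automorphism fixing the affine group -/

/-- An automorphism fixing `2 x` preserves the filtration: the elements of `Γ (k + 1)` are the
`(f ^ 2 ^ k)⁻¹ * scale 2 f` for `f` in `Γ k`. -/
theorem map_mem_Γ {σ : MulAut FormalDiff} (hσ : σ (lin two) = lin two) {k : ℕ} (hk : 1 ≤ k)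
    {f : FormalDiff} (hf : f ∈ Γ k) : σ f ∈ Γ k := by
  induction k, hk using Nat.le_induction generalizing f with
  | base => exact map_mem_Γ_one σ hf
  | succ k hk ih =>
    obtain ⟨h, hh, e⟩ := exists_pow_mul_eq_scale (k := k + 1) (e := 2 ^ k) (μ := two) (by omega)
      (fun m hm h => by
        rw [coe_two] at h
        have h' : 2 ^ m = 2 ^ k := by exact_mod_cast h
        have := Nat.pow_right_injective le_rfl h'
        omega) hf
    have hs : σ h ∈ Γ k := ih (Γ_mono k.le_succ hh)
    have e' : σ h ^ 2 ^ k * σ f = scale two (σ h) := by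
      rw [← map_pow, ← map_mul, e, map_scale σ hσ]
    have hf' : σ f ∈ Γ k := ih (Γ_mono k.le_succ hf)
    refine (mem_Γ_succ hk).mpr ⟨hf', ?_⟩
    have := congrArg (fun f => coeff f (k + 1)) e'
    simp only [mul_coeff_succ hk (pow_mem hs _) hf', pow_coeff_succ hk hs, scale_coeff,
      coe_two] at this
    push_cast at this
    linear_combination this

theorem map_sameJet {σ : MulAut FormalDiff} (hσ : σ (lin two) = lin two) {k : ℕ} (hk : 1 ≤ k)
    {f g : FormalDiff} (h : SameJet k f g) : SameJet k (σ f) (σ g) := by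
  rw [sameJet_iff_inv_mul_mem, ← map_inv, ← map_mul]
  exact map_mem_Γ hσ hk (sameJet_iff_inv_mul_mem.mp h)

/-- The formal diffeomorphism `x + x ^ (k + 1)` (and `2 x` for `k = 0`). -/
noncomputable def binom (k : ℕ) : FormalDiff :=
  ofCoeff (fun n => (if n = 1 then 1 else 0) + if n = k + 1 then 1 else 0) (by simp) (by
    rw [if_pos rfl]; split_ifs <;> norm_num)

theorem binom_mem {k : ℕ} (hk : 1 ≤ k) : binom k ∈ Γ k := fun i hi => by
  rcases eq_or_ne i 1 with rfl | h1
  · simp [binom]; omega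
  · rw [one_coeff_of_ne h1]
    simp [binom, h1]; omega

theorem binom_coeff {k : ℕ} (hk : 1 ≤ k) : (binom k).coeff (k + 1) = 1 := by
  simp [binom]; omega

/-- An automorphism fixing the linear maps multiplies the leading coefficients of the elements of
`Γ k` by a constant. -/
theorem map_coeff_succ {σ : MulAut FormalDiff} (hσ : ∀ a, σ (lin a) = lin a) {k : ℕ}
    (hk : 1 ≤ k) {f : FormalDiff} (hf : f ∈ Γ k) :
    (σ f).coeff (k + 1) = (σ (binom k)).coeff (k + 1) * f.coeff (k + 1) := by
  by_cases ha : f.coeff (k + 1) = 0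
  · have h := map_mem_Γ (hσ two) (by omega) ((mem_Γ_succ hk).mpr ⟨hf, ha⟩)
    rw [((mem_Γ_succ hk).mp h).2, ha, mul_zero]
  · obtain ⟨z, hz⟩ := IsAlgClosed.exists_pow_nat_eq (f.coeff (k + 1)) hk
    have hz0 : z ≠ 0 := fun h => ha (by rw [← hz, h, zero_pow (by omega)])
    have hj : SameJet (k + 1) f (scale (Units.mk0 z hz0) (binom k)) := by
      refine SameJet.succ (SameJet.trans hf (SameJet.symm (scale_mem_Γ (binom_mem hk) _))) ?_
      rw [scale_coeff, binom_coeff hk, mul_one, Units.val_mk0, hz]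
    rw [map_sameJet (hσ two) (by omega) hj _ le_rfl, map_scale σ (hσ _), scale_coeff,
      Units.val_mk0, hz, mul_comm]

/-- The constants by which an automorphism fixing the affine group multiplies the leading
coefficients are all `1`: they are multiplicative by the formula for commutators. -/
theorem map_binom_coeff {σ : MulAut FormalDiff} (hσ : ∀ a, σ (lin a) = lin a)
    (hσ' : σ (parabolic 1) = parabolic 1) {k : ℕ} (hk : 1 ≤ k) :
    (σ (binom k)).coeff (k + 1) = 1 := by
  set c : ℕ → ℂ := fun k => (σ (binom k)).coeff (k + 1) with hc
  have hmul : ∀ k l, 1 ≤ k → 1 ≤ l → k ≠ l → c (k + l) = c k * c l := fun k l hk hl hkl => by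
    obtain ⟨hj, hd⟩ := mul_coeff_sub_mul_coeff hk hl (binom_mem hk) (binom_mem hl)
    obtain ⟨-, hd'⟩ := mul_coeff_sub_mul_coeff hk hl (map_mem_Γ (hσ two) hk (binom_mem hk))
      (map_mem_Γ (hσ two) hl (binom_mem hl))
    rw [binom_coeff hk, binom_coeff hl] at hd
    set p := binom k * binom l with hp
    set q := binom l * binom k with hq
    have hw : q⁻¹ * p ∈ Γ (k + l) := sameJet_iff_inv_mul_mem.mp hj
    have hw' := map_mem_Γ (hσ two) (by omega) hw
    -- The coefficient of the commutator `q⁻¹ * p`, and of its image.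
    have h₁ := (SameJet.mul_left hw q).2
    have h₂ := (SameJet.mul_left hw' (σ q)).2
    rw [mul_one, mul_inv_cancel_left, one_coeff_of_ne (by omega), sub_zero, hd, coeff_one_of_mem
      le_rfl (mul_mem (Γ_mono hl (binom_mem hl)) (Γ_mono hk (binom_mem hk)))] at h₁
    rw [mul_one, ← map_mul, mul_inv_cancel_left, one_coeff_of_ne (by omega), sub_zero, hp, hq,
      map_mul, map_mul, hd', ← map_mul, coeff_one_of_mem le_rfl (map_mem_Γ_one σ
      (mul_mem (Γ_mono hl (binom_mem hl)) (Γ_mono hk (binom_mem hk)))), ← hp, ← hq,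
      map_coeff_succ hσ (by omega) hw] at h₂
    have hne : (k : ℂ) - l ≠ 0 := sub_ne_zero.mpr (by exact_mod_cast hkl)
    refine mul_left_cancel₀ hne ?_
    simp only [hc]
    linear_combination (-(σ (binom (k + l))).coeff (k + l + 1)) * (-h₁) - h₂
  have hne : ∀ k, 1 ≤ k → c k ≠ 0 := fun k hk h => by
    have h' := map_mem_Γ (σ := σ⁻¹) (by rw [MulAut.inv_apply, MulEquiv.symm_apply_eq, hσ])
      (by omega) ((mem_Γ_succ hk).mpr ⟨map_mem_Γ (hσ two) hk (binom_mem hk), h⟩)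
    rw [MulAut.inv_apply_self, mem_Γ_succ hk, binom_coeff hk] at h'
    exact one_ne_zero h'.2
  have h1 : c 1 = 1 := by
    have := map_coeff_succ hσ le_rfl (parabolic_mem 1)
    rw [hσ', parabolic_coeff_succ, one_pow, mul_one] at this
    exact this.symm
  have h2 : ∀ k, 2 ≤ k → c k = c 2 := fun k hk => by
    induction k, hk using Nat.le_induction with
    | base => rfl
    | succ k hk ih => rw [hmul k 1 (by omega) le_rfl (by omega), h1, mul_one, ih]
  have h2' : c 2 = 1 := by
    have := hmul 2 3 (by omega) (by omega) (by omega)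
    rw [h2 (2 + 3) (by omega), h2 3 (by omega)] at this
    exact (mul_left_cancel₀ (hne 2 (by omega)) (by rw [mul_one]; exact this)).symm
  rcases eq_or_lt_of_le hk with rfl | hk
  · exact h1
  · exact (h2 k hk).trans h2'

/-- An automorphism that is trivial on the graded pieces of the filtration and commutes with
`scale 2` is trivial on `Γ 1`, as `scale 2` has distinct eigenvalues on distinct pieces. -/
theorem map_eq_self_of_mem {σ : MulAut FormalDiff} (hσ : ∀ a, σ (lin a) = lin a)
    (hσ' : σ (parabolic 1) = parabolic 1) {f : FormalDiff} (hf : f ∈ Γ 1) : σ f = f := by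
  refine eq_of_forall_sameJet fun n hn => ?_
  induction n, hn using Nat.le_induction generalizing f with
  | base => exact SameJet.trans (map_mem_Γ_one σ hf) (SameJet.symm hf)
  | succ n hn ih =>
    -- By induction `f ↦ (σ f - f)_{n + 1}` is an additive function on `Γ 1`, which `scale 2`
    -- multiplies by `2 ^ n`. On `Γ j` modulo `Γ (j + 1)`, `scale 2` is the power `2 ^ j`.
    have main : ∀ j, 1 ≤ j → j ≤ n → ∀ f ∈ Γ j, (σ f).coeff (n + 1) - f.coeff (n + 1) = 0 := by
      intro j hj hjn
      induction hjn using Nat.decreasingInduction with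
      | self =>
        intro f hf
        rw [map_coeff_succ hσ hn hf, map_binom_coeff hσ hσ' hn, one_mul, sub_self]
      | of_succ j hjn ihj =>
        intro f hf
        have hf1 := Γ_mono hj hf
        set g := (f ^ 2 ^ j)⁻¹ * scale two f with hg
        have hfg : f ^ 2 ^ j * g = scale two f := mul_inv_cancel_left _ _
        have hgj : g ∈ Γ j := mul_mem (inv_mem (pow_mem hf _)) (scale_mem_Γ hf _)
        have hgj' : g ∈ Γ (j + 1) := by
          refine (mem_Γ_succ hj).mpr ⟨hgj, ?_⟩
          have := mul_coeff_succ hj (pow_mem hf (2 ^ j)) hgj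
          rw [hfg, scale_coeff, pow_coeff_succ hj hf, coe_two] at this
          push_cast at this
          linear_combination -this
        have hpow := pow_coeff_succ_sub (map_mem_Γ_one σ hf1) hf1 (ih hf1) (2 ^ j)
        have hd := hpow.1.mul_coeff_succ (ih (Γ_mono hj hgj))
        rw [ihj (by omega) g hgj', mul_zero, add_zero, hpow.2,
          coeff_one_of_mem le_rfl (map_mem_Γ_one σ (Γ_mono hj hgj)), ← map_pow, ← map_mul, hfg,
          map_scale σ (hσ two), scale_coeff, scale_coeff, one_pow, mul_one, coe_two] at hd
        push_cast at hd
        have hne : (2 : ℂ) ^ n - 2 ^ j ≠ 0 := sub_ne_zero.mpr fun h => by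
          have h' : 2 ^ n = 2 ^ j := by exact_mod_cast h
          have := Nat.pow_right_injective le_rfl h'
          omega
        exact (mul_eq_zero.mp (show ((2 : ℂ) ^ n - 2 ^ j) * _ = 0 by
          linear_combination hd)).resolve_left hne
    exact (ih hf).succ (sub_eq_zero.mp (main 1 le_rfl hn f hf))

theorem eq_one_of_fixes_affine {σ : MulAut FormalDiff} (hσ : ∀ a, σ (lin a) = lin a)
    (hσ' : σ (parabolic 1) = parabolic 1) : σ = 1 := by
  ext1 f
  let a : ℂˣ := Units.mk0 _ f.coeff_one_ne_zero
  have h : lin a⁻¹ * f ∈ Γ 1 := mem_Γ_one.mpr (by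
    rw [lin_mul_coeff, show f.coeff 1 = (a : ℂ) from rfl, Units.inv_mul])
  have := map_eq_self_of_mem hσ hσ' h
  rw [map_mul, hσ] at this
  exact mul_left_cancel this

/-! ### The automorphism group -/

theorem fieldAut_lin (τ : RingAut ℂ) (a : ℂˣ) :
    fieldAut τ (lin a) = lin (Units.map (τ : ℂ →* ℂ) a) := by
  refine ext_coeff fun n => ?_
  rw [fieldAut_coeff, lin_coeff, lin_coeff]
  split_ifs <;> simp

theorem fieldAut_parabolic_one (τ : RingAut ℂ) : fieldAut τ (parabolic 1) = parabolic 1 := by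
  refine ext_coeff fun n => ?_
  rw [fieldAut_coeff]
  rcases n with _ | n
  · simp
  · simp

theorem exists_eq_conj_mul_fieldAut (σ : MulAut FormalDiff) :
    ∃ (φ : FormalDiff) (τ : RingAut ℂ), σ = MulAut.conj φ * fieldAut τ := by
  obtain ⟨φ, τ, hlin, hpar⟩ := exists_conj_map_affine σ
  refine ⟨φ⁻¹, τ, ?_⟩
  have h : (fieldAut τ)⁻¹ * (MulAut.conj φ * σ) = 1 := by
    refine eq_one_of_fixes_affine (fun a => ?_) ?_
    · rw [MulAut.mul_apply, hlin, MulAut.inv_apply, MulEquiv.symm_apply_eq, fieldAut_lin]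
    · rw [MulAut.mul_apply, hpar, MulAut.inv_apply, MulEquiv.symm_apply_eq,
        fieldAut_parabolic_one]
  rw [map_inv, eq_inv_mul_iff_mul_eq]
  exact (inv_mul_eq_one.mp h).symm

/-- An inner `fieldAut τ` preserves the multipliers of the linear maps, so `τ` is trivial. -/
theorem eq_one_of_fieldAut_mem_Inn {τ : RingAut ℂ} (h : fieldAut τ ∈ Inn FormalDiff) : τ = 1 := by
  obtain ⟨φ, hφ⟩ := h
  ext z
  rcases eq_or_ne z 0 with rfl | hz
  · simp
  have := congrArg (fun σ : MulAut FormalDiff => multiplier (σ (lin (Units.mk0 z hz)))) hφ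
  simp only [MulAut.conj_apply, fieldAut_lin] at this
  rw [map_mul, map_mul, mul_right_comm, ← map_mul, mul_inv_cancel, map_one, one_mul] at this
  simpa [multiplier_apply] using this.symm

end FormalDiff

theorem theoremD :
    Inn FormalDiff ⊔ FormalDiff.fieldAut.range = ⊤ ∧
    (∀ σ : MulAut FormalDiff, ∃ (φ : FormalDiff) (τ : RingAut ℂ),
      σ = MulAut.conj φ * FormalDiff.fieldAut τ) ∧
    (∃ e : RingAut ℂ ≃* Out FormalDiff,
      ∀ τ : RingAut ℂ, e τ = QuotientGroup.mk' (Inn FormalDiff) (FormalDiff.fieldAut τ)) := by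
  refine ⟨eq_top_iff.mpr fun σ _ => ?_, FormalDiff.exists_eq_conj_mul_fieldAut,
    MulEquiv.ofBijective ((QuotientGroup.mk' (Inn FormalDiff)).comp FormalDiff.fieldAut)
      ⟨(injective_iff_map_eq_one _).mpr fun τ hτ => ?_, fun x => ?_⟩, fun τ => rfl⟩
  · obtain ⟨φ, τ, rfl⟩ := FormalDiff.exists_eq_conj_mul_fieldAut σ
    exact Subgroup.mul_mem_sup ⟨φ, rfl⟩ ⟨τ, rfl⟩
  · exact FormalDiff.eq_one_of_fieldAut_mem_Inn ((QuotientGroup.eq_one_iff _).mp hτ)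
  · obtain ⟨σ, rfl⟩ := QuotientGroup.mk'_surjective _ x
    obtain ⟨φ, τ, rfl⟩ := FormalDiff.exists_eq_conj_mul_fieldAut σ
    refine ⟨τ, ?_⟩
    have h : QuotientGroup.mk' (Inn FormalDiff) (MulAut.conj φ) = 1 :=
      (QuotientGroup.eq_one_iff _).mpr ⟨φ, rfl⟩
    rw [map_mul, h, one_mul]
    rfl
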